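/- Let $C=\mathbb R/\mathbb Z$ be the circle of circumference $1$ with its arclength metric, and let $\ell_1\ge\ell_2\ge\cdots>0$ be a decreasing sequence of positive numbers with $\ell_n\to0$. Given centers $U_{n,t}\in C$ ($n\ge1$, $t\ge0$), let $I_{n,t}$ be the open arc of $C$ with center $U_{n,t}$ and length $\ell_n$ (the whole circle if $\ell_n>1$), let $E_t=\limsup_n I_{n,t}$ be the set of points lying in infinitely many of the arcs $I_{n,t}$, and let $$T=\{t\in[0,1] : E_t \text{ is not dense in } C\}.$$ *Brownian model.* The processes $(U_{n,t})_{t\ge0}$, $n\ge1$, are independent standard Brownian motions on $C$ started uniformly: $U_{n,t}=V_n+B_{n,t} \bmod 1$, where $V_n$ is uniform on $C$, $B_n$ is a standard real Brownian motion with (almost surely) continuous paths started at $0$, and all the $V_n$ and $B_n$ are independent. *Poisson model with parameter $\alpha\ge0$.* Let $C_{n,j}$ (uniform on $C$) and $Y_{n,j}$ (exponential with rate $\ell_n^{-\alpha}$), $n,j\ge1$, all be independent, put $T_{n,0}=0$ and $T_{n,j}=\sum_{k=1}^{j}Y_{n,k}$, and let $U_{n,t}=\sum_{j\ge1}C_{n,j}\mathbf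 1_{[T_{n,j-1},T_{n,j})}(t)$; that is, the $n$-th arc gets a new uniform center at the times of a Poisson process of rate $\ell_n^{-\alpha}$. **Theorem 1.8.** (a) In the Brownian model, for every such sequence $(\ell_n)$, almost surely $T=\emptyset$. (b) In the Poisson model with $\alpha>0$, if there is a real $c$ with $\ell_n\ge n^{-c}$ for all $n\ge1$, then almost surely $T=\emptyset$. In the Poisson model with $\alpha=0$, for every such sequence $(\ell_n)$, almost surely $T=\emptyset$. (c) For every $\alpha>0$ there is such a sequence $(\ell_n)$, which can moreover be taken strictly decreasing and with $\ell_1\le 1/2$, for which in the Poisson model with parameter $\alpha$ almost surely $T\ne\emptyset$. -/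

import Mathlib

open MeasureTheory ProbabilityTheory Filter Topology
open scoped NNReal ENNReal

/-- The circle of circumference `1` with its arclength metric and its uniform probability
measure `volume`; the covering map from the line is the quotient map `ℝ → ℝ / ℤ`. -/
abbrev Circ : Type := UnitAddCircle

/-- A decreasing sequence of positive numbers tending to `0`. Sequences are indexed from `0`, so
`ℓ n` is the length of the `(n + 1)`-st arc. -/
structure IsLengthSeq (ℓ : ℕ → ℝ) : Prop where
  pos : ∀ n, 0 < ℓ n
  anti : Antitone ℓ
  tendsto_zero : Tendsto ℓ atTop (𝓝 0)

/-- The open arc with center `c` and length `r` (the whole circle if `r > 1`). -/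
def openArc (c : Circ) (r : ℝ) : Set Circ := Metric.ball c (r / 2)

/-- `E_t`: the set of points that lie in infinitely many of the arcs at time `t`, where `u n t` is
the center of the `n`-th arc at time `t`. -/
def coveredIO (ℓ : ℕ → ℝ) (u : ℕ → ℝ≥0 → Circ) (t : ℝ≥0) : Set Circ :=
  limsup (fun n => openArc (u n t) (ℓ n)) atTop

/-- The set of times `t ∈ [0, 1]` at which `E_t` is not dense in the circle. -/
def nonDenseTimes (ℓ : ℕ → ℝ) (u : ℕ → ℝ≥0 → Circ) : Set ℝ≥0 :=
  {t | t ∈ Set.Icc 0 1 ∧ ¬ Dense (coveredIO ℓ u t)}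

/-- The data of the Brownian model: starting points `V i`, uniform on the circle, and standard
real Brownian motions `B i` started at `0`; for each `i` the starting point and the Brownian motion
are independent, and the pairs `(V i, B i)` are independent for different `i`. -/
structure IsBrownianModel {Ω : Type*} [MeasurableSpace Ω] (P : Measure Ω)
    (V : ℕ → Ω → Circ) (B : ℕ → ℝ≥0 → Ω → ℝ) : Prop where
  measurable_start : ∀ i, Measurable (V i)
  measurable_motion : ∀ i t, Measurable (B i t)
  law_start : ∀ i, HasLaw (V i) (volume : Measure Circ) P
  brownian : ∀ i, IsBrownianReal (B i) P
  indep_start_motion : ∀ i, IndepFun (V i) (fun ω (t : ℝ≥0) => B i t ω) P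
  indep : iIndepFun (fun (i : ℕ) (ω : Ω) => (V i ω, fun t : ℝ≥0 => B i t ω)) P

/-- The centers in the Brownian model: Brownian motion on the circle is the image of Brownian
motion on the line under the covering map, translated to the starting point. -/
noncomputable def brownianCenter {Ω : Type*} (V : ℕ → Ω → Circ) (B : ℕ → ℝ≥0 → Ω → ℝ) (ω : Ω)
    (i : ℕ) (t : ℝ≥0) : Circ :=
  V i ω + ((B i t ω : ℝ) : Circ)

/-- The data of the Poisson model with parameter `α` and lengths `ℓ`: uniform positions `C i j`
and exponential waiting times `Y i j` with rate `(ℓ i) ^ (-α)`, all of them independent (the pairs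
`(C i j, Y i j)` are independent, and so are the two members of each pair). The indices `i` and `j`
start from `0`. -/
structure IsPoissonModel {Ω : Type*} [MeasurableSpace Ω] (P : Measure Ω) (α : ℝ) (ℓ : ℕ → ℝ)
    (C : ℕ → ℕ → Ω → Circ) (Y : ℕ → ℕ → Ω → ℝ) : Prop where
  measurable_position : ∀ i j, Measurable (C i j)
  measurable_wait : ∀ i j, Measurable (Y i j)
  law_position : ∀ i j, HasLaw (C i j) (volume : Measure Circ) P
  law_wait : ∀ i j, HasLaw (Y i j) (expMeasure (ℓ i ^ (-α))) P
  indep_position_wait : ∀ i j, IndepFun (C i j) (Y i j) P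
  indep : iIndepFun (fun (p : ℕ × ℕ) (ω : Ω) => (C p.1 p.2 ω, Y p.1 p.2 ω)) P

/-- The time of the `j`-th update of arc `i`, with `updateTime Y ω i 0 = 0`. -/
noncomputable def updateTime {Ω : Type*} (Y : ℕ → ℕ → Ω → ℝ) (ω : Ω) (i j : ℕ) : ℝ :=
  ∑ k ∈ Finset.range j, Y i k ω

/-- The centers in the Poisson model: between its `j`-th and its `(j + 1)`-st update time arc `i`
is centered at `C i j`. Almost surely, at each time exactly one term of the sum has a nonzero
indicator. -/
noncomputable def poissonCenter {Ω : Type*} (C : ℕ → ℕ → Ω → Circ) (Y : ℕ → ℕ → Ω → ℝ) (ω : Ω)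
    (i : ℕ) (t : ℝ≥0) : Circ :=
  ∑' j : ℕ, (Set.Ico (updateTime Y ω i j) (updateTime Y ω i (j + 1))).indicator
    (fun _ => C i j ω) (t : ℝ)

/-! `E_t` is a countable intersection of open unions of arcs, so by Baire it is dense as soon as the
centers at time `t` accumulate at every point. For (a) and (b) it is therefore enough to fix a ball
and show that, almost surely, at every time infinitely many centers lie in it. The uncountably many
times are handled by making centers stay in the ball throughout an interval.

Brownian model: the motions do not depend on the lengths. By path continuity, an arc stays in the
ball during some neighbourhood of a given time with positive probability, the same for all arcs. The
second Borel–Cantelli lemma gives infinitely many such arcs, and countably many neighbourhoods cover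
the time axis (`IsBrownianModel.exists_frequently_mem`).

Poisson model, rates at most `(n + 1) ^ K`: cut `[0, 1]` into cells no longer than the mean waiting
times of `M` given arcs. In one cell all these arcs fail to stand still in the ball with probability
at most `q ^ M`, `q < 1`, while the number of cells is polynomial in `M`
(`IsPoissonModel.ae_frequently_mem`).

Part (c): it suffices that at some time all but finitely many centers are close to the point
opposite to `0`. The lengths decrease so fast that in every window of length `h n` the `n`-th arc
very probably updates often enough to hit the target and then rests there for a time `h (n + 1)`. By
the first Borel–Cantelli lemma this fails for only finitely many `n`, and nested rest intervals have
a common time (`exists_time_of_nested`). -/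

/-! ### The renewal process of a single Poisson arc -/

lemma expMeasure_Ioi {r x : ℝ} (hr : 0 < r) (hx : 0 ≤ x) :
    expMeasure r (Set.Ioi x) = ENNReal.ofReal (Real.exp (-(r * x))) := by
  have := isProbabilityMeasure_expMeasure hr
  have h := cdf_expMeasure_eq hr x
  rw [cdf_eq_real, if_pos hx] at h
  have h2 : (expMeasure r).real (Set.Ioi x) = Real.exp (-(r * x)) := by
    rw [← Set.compl_Iic, probReal_compl_eq_one_sub measurableSet_Iic, h]; ring
  rw [← h2, ofReal_measureReal]

lemma expMeasure_Iic_le {r x : ℝ} (hr : 0 < r) (hx : 0 ≤ x) :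
    expMeasure r (Set.Iic x) ≤ ENNReal.ofReal (r * x) := by
  have := isProbabilityMeasure_expMeasure hr
  have h := cdf_expMeasure_eq hr x
  rw [cdf_eq_real, if_pos hx] at h
  rw [← ofReal_measureReal, h]
  apply ENNReal.ofReal_le_ofReal
  linarith [Real.add_one_le_exp (-(r * x))]

/-- One arc of the Poisson model, with update rate `r`. -/
structure IsPoissonArc {Ω : Type*} [MeasurableSpace Ω] (P : Measure Ω) (r : ℝ)
    (C : ℕ → Ω → Circ) (Y : ℕ → Ω → ℝ) : Prop where
  rate_pos : 0 < r
  measurable_position : ∀ j, Measurable (C j)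
  measurable_wait : ∀ j, Measurable (Y j)
  law_position : ∀ j, HasLaw (C j) (volume : Measure Circ) P
  law_wait : ∀ j, HasLaw (Y j) (expMeasure r) P
  indep_position_wait : ∀ j, IndepFun (C j) (Y j) P
  indep : iIndepFun (fun j ω => (C j ω, Y j ω)) P

lemma IsPoissonModel.arc {Ω : Type*} [MeasurableSpace Ω] {P : Measure Ω} {α : ℝ} {ℓ : ℕ → ℝ}
    {C : ℕ → ℕ → Ω → Circ} {Y : ℕ → ℕ → Ω → ℝ} (h : IsPoissonModel P α ℓ C Y)
    (hℓ : ∀ n, 0 < ℓ n) (i : ℕ) : IsPoissonArc P (ℓ i ^ (-α)) (C i) (Y i) where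
  rate_pos := Real.rpow_pos_of_pos (hℓ i) _
  measurable_position := h.measurable_position i
  measurable_wait := h.measurable_wait i
  law_position := h.law_position i
  law_wait := h.law_wait i
  indep_position_wait := h.indep_position_wait i
  indep := h.indep.precomp (g := fun j => (i, j)) (fun a b hab => by simpa using hab)

/-- The partial sums of the waiting times. -/
noncomputable def waitSum {Ω : Type*} (Y : ℕ → Ω → ℝ) (j : ℕ) (ω : Ω) : ℝ :=
  ∑ k ∈ Finset.range j, Y k ω

/-- The event that the `j`-th renewal interval contains the time `a`. -/
def currentAt {Ω : Type*} (Y : ℕ → Ω → ℝ) (a : ℝ) (j : ℕ) : Set Ω :=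
  {ω | waitSum Y j ω ≤ a ∧ a < waitSum Y (j + 1) ω}

lemma waitSum_succ {Ω : Type*} (Y : ℕ → Ω → ℝ) (j : ℕ) (ω : Ω) :
    waitSum Y (j + 1) ω = waitSum Y j ω + Y j ω := Finset.sum_range_succ _ _

lemma waitSum_zero {Ω : Type*} (Y : ℕ → Ω → ℝ) (ω : Ω) : waitSum Y 0 ω = 0 := by
  simp [waitSum]

lemma waitSum_monotone {Ω : Type*} {Y : ℕ → Ω → ℝ} {ω : Ω} (h : ∀ j, 0 ≤ Y j ω) :
    Monotone (fun j => waitSum Y j ω) :=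
  monotone_nat_of_le_succ fun j => by rw [waitSum_succ]; linarith [h j]

lemma measurable_waitSum {Ω : Type*} [MeasurableSpace Ω] {Y : ℕ → Ω → ℝ}
    (h : ∀ j, Measurable (Y j)) (j : ℕ) : Measurable (waitSum Y j) := by
  unfold waitSum; exact Finset.measurable_fun_sum _ fun k _ => h k

/-- For nonnegative waiting times a time belongs to at most one renewal interval. -/
lemma index_unique_of_mem {Ω : Type*} {Y : ℕ → Ω → ℝ} {ω : Ω} (h : ∀ j, 0 ≤ Y j ω) {a : ℝ}
    {i j : ℕ} (hi : ω ∈ currentAt Y a i) (hj : ω ∈ currentAt Y a j) : i = j := by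
  have key : ∀ i j : ℕ, ω ∈ currentAt Y a i → ω ∈ currentAt Y a j → ¬ i < j := by
    intro i j hi hj hij
    have := waitSum_monotone h (show i + 1 ≤ j from hij)
    exact absurd (hi.2.trans_le (this.trans hj.1)) (lt_irrefl _)
  exact le_antisymm (not_lt.1 (key j i hj hi)) (not_lt.1 (key i j hi hj))

namespace IsPoissonArc

variable {Ω : Type*} [MeasurableSpace Ω] {P : Measure Ω} {r : ℝ}
  {C : ℕ → Ω → Circ} {Y : ℕ → Ω → ℝ}

lemma isProbabilityMeasure (h : IsPoissonArc P r C Y) : IsProbabilityMeasure P :=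
  h.indep.isProbabilityMeasure

lemma measurable_pair (h : IsPoissonArc P r C Y) (j : ℕ) :
    Measurable (fun ω => (C j ω, Y j ω)) :=
  (h.measurable_position j).prodMk (h.measurable_wait j)

lemma measurableSet_currentAt (h : IsPoissonArc P r C Y) (a : ℝ) (j : ℕ) :
    MeasurableSet (currentAt Y a j) :=
  (measurableSet_le (measurable_waitSum h.measurable_wait j) measurable_const).inter
    (measurableSet_lt measurable_const (measurable_waitSum h.measurable_wait (j + 1)))

lemma wait_gt (h : IsPoissonArc P r C Y) (j : ℕ) {x : ℝ} (hx : 0 ≤ x) :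
    P {ω | x < Y j ω} = ENNReal.ofReal (Real.exp (-(r * x))) := by
  rw [← expMeasure_Ioi h.rate_pos hx, ← (h.law_wait j).map_eq,
    Measure.map_apply (h.measurable_wait j) measurableSet_Ioi]
  rfl

lemma wait_le (h : IsPoissonArc P r C Y) (j : ℕ) {x : ℝ} (hx : 0 ≤ x) :
    P {ω | Y j ω ≤ x} ≤ ENNReal.ofReal (r * x) := by
  refine le_of_eq_of_le ?_ (expMeasure_Iic_le h.rate_pos hx)
  rw [← (h.law_wait j).map_eq, Measure.map_apply (h.measurable_wait j) measurableSet_Iic]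
  rfl

lemma ae_wait_pos (h : IsPoissonArc P r C Y) : ∀ᵐ ω ∂P, ∀ j, 0 < Y j ω := by
  rw [ae_all_iff]
  intro j
  rw [ae_iff]
  have := h.wait_le j le_rfl
  simpa using this

/-- There is no explosion: by the second Borel–Cantelli lemma infinitely many waiting times exceed
`1`, so the update times are unbounded. -/
lemma ae_exists_index (h : IsPoissonArc P r C Y) :
    ∀ᵐ ω ∂P, ∀ a : ℝ, 0 ≤ a → ∃ j, ω ∈ currentAt Y a j := by
  have := h.isProbabilityMeasure
  have hm : ∀ j, MeasurableSet {ω | 1 < Y j ω} := fun j =>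
    measurableSet_lt measurable_const (h.measurable_wait j)
  have hind : iIndepSet (fun j => {ω | 1 < Y j ω}) P := by
    rw [iIndepSet_iff_meas_biInter hm]
    intro s
    exact h.indep.measure_inter_preimage_eq_mul s (sets := fun _ => {p | 1 < p.2})
      (fun j _ => measurableSet_lt measurable_const measurable_snd)
  have hsum : (∑' j, P {ω | 1 < Y j ω}) = ∞ := by
    simp_rw [h.wait_gt _ zero_le_one]
    exact ENNReal.tsum_const_eq_top_of_ne_zero (by simp [Real.exp_pos])
  have h1 := measure_limsup_eq_one hm hind hsum
  have hms : MeasurableSet (limsup (fun j => {ω | 1 < Y j ω}) atTop) :=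
    MeasurableSet.measurableSet_limsup hm
  have h2 : ∀ᵐ ω ∂P, ω ∈ limsup (fun j => {ω | 1 < Y j ω}) atTop := by
    rw [← prob_compl_eq_zero_iff hms] at h1
    exact h1
  filter_upwards [h2, h.ae_wait_pos] with ω hω hpos a ha
  rw [mem_limsup_iff_frequently_mem] at hω
  have hmono := waitSum_monotone (fun j => (hpos j).le)
  have hunb : ∀ m : ℕ, ∃ j, (m : ℝ) ≤ waitSum Y j ω := by
    intro m
    induction m with
    | zero => exact ⟨0, by simp [waitSum_zero]⟩
    | succ m ih =>
      obtain ⟨j, hj⟩ := ih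
      obtain ⟨i, hi, hi'⟩ := hω.forall_exists_of_atTop j
      refine ⟨i + 1, ?_⟩
      have h3 : waitSum Y j ω ≤ waitSum Y i ω := hmono hi
      have h4 : 1 < Y i ω := hi'
      rw [waitSum_succ]; push_cast; linarith
  obtain ⟨m, hm⟩ := exists_nat_gt a
  obtain ⟨j, hj⟩ := hunb m
  classical
  have hex : ∃ j, a < waitSum Y j ω := ⟨j, hm.trans_le hj⟩
  have h0 : Nat.find hex ≠ 0 := by
    intro h0
    have := Nat.find_spec hex
    rw [h0, waitSum_zero] at this
    linarith
  obtain ⟨i, hi⟩ := Nat.exists_eq_succ_of_ne_zero h0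
  refine ⟨i, not_lt.1 (Nat.find_min hex (by omega)), ?_⟩
  have := Nat.find_spec hex
  rwa [hi] at this

/-- To bound the probability of an event it suffices to bound its conditional probabilities given
the number of updates before a fixed time. -/
lemma measure_le_of_currentAt (h : IsPoissonArc P r C Y) {a : ℝ} (ha : 0 ≤ a) {S : Set Ω}
    {ε : ℝ≥0∞} (hS : ∀ j, P (currentAt Y a j ∩ S) ≤ ε * P (currentAt Y a j)) : P S ≤ ε := by
  have := h.isProbabilityMeasure
  have hsum : ∑' j, P (currentAt Y a j) ≤ 1 := by
    rw [← measure_iUnion₀]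
    · exact prob_le_one
    · intro i j hij
      refine measure_mono_null ?_ (ae_iff.1 h.ae_wait_pos)
      rintro ω ⟨hi, hj⟩ hpos
      exact hij (index_unique_of_mem (fun j => (hpos j).le) hi hj)
    · exact fun j => (h.measurableSet_currentAt a j).nullMeasurableSet
  calc P S ≤ P (⋃ j, currentAt Y a j ∩ S) := by
        apply measure_mono_ae
        filter_upwards [h.ae_exists_index] with ω hω hS
        obtain ⟨j, hj⟩ := hω a ha
        exact Set.mem_iUnion.2 ⟨j, hj, hS⟩
    _ ≤ ∑' j, P (currentAt Y a j ∩ S) := measure_iUnion_le _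
    _ ≤ ∑' j, ε * P (currentAt Y a j) := ENNReal.tsum_le_tsum hS
    _ = ε * ∑' j, P (currentAt Y a j) := ENNReal.tsum_mul_left
    _ ≤ ε * 1 := by gcongr
    _ = ε := mul_one _

lemma indepFun_waitSum (h : IsPoissonArc P r C Y) (j : ℕ) :
    IndepFun (waitSum Y j) (fun ω => (C j ω, Y j ω)) P := by
  have h1 := h.indep.indepFun_finset (Finset.range j) {j} (by simp) h.measurable_pair
  have h2 := h1.comp (φ := fun f => ∑ k : Finset.range j, (f k).2)
    (ψ := fun f : ({j} : Finset ℕ) → Circ × ℝ => f ⟨j, by simp⟩)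
    (Finset.measurable_fun_sum _ fun k _ => (measurable_pi_apply k).snd)
    (measurable_pi_apply (X := fun _ : ({j} : Finset ℕ) => Circ × ℝ) ⟨j, by simp⟩)
  convert h2 using 1
  · ext ω
    simp only [waitSum, Function.comp]
    exact (Finset.sum_coe_sort (Finset.range j) (fun k => Y k ω)).symm
  · rfl

/-- Memorylessness: the residual waiting time at time `a`, and the current position. -/
lemma measure_run (h : IsPoissonArc P r C Y) {a b : ℝ} (hab : a ≤ b) {J : Set Circ}
    (hJ : MeasurableSet J) (j : ℕ) :
    P {ω | waitSum Y j ω ≤ a ∧ b < waitSum Y (j + 1) ω ∧ C j ω ∈ J} =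
      volume J * ENNReal.ofReal (Real.exp (-(r * (b - a)))) * P (currentAt Y a j) := by
  have := h.isProbabilityMeasure
  have := isProbabilityMeasure_expMeasure h.rate_pos
  have hmW := measurable_waitSum h.measurable_wait j
  -- Stated for general `b` and `J` because it is used twice, the second time with `b = a` and `J =
  -- univ`. The two integrands then differ by a factor that does not depend on `x`.
  have key : ∀ b, a ≤ b → ∀ J : Set Circ, MeasurableSet J →
      P {ω | waitSum Y j ω ≤ a ∧ b < waitSum Y (j + 1) ω ∧ C j ω ∈ J} =
      ∫⁻ x in Set.Iic a, volume J * ENNReal.ofReal (Real.exp (-(r * (b - x))))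
        ∂(P.map (waitSum Y j)) := by
    intro b hab J hJ
    have hlaw : P.map (fun ω => (waitSum Y j ω, (C j ω, Y j ω))) =
        (P.map (waitSum Y j)).prod ((volume : Measure Circ).prod (expMeasure r)) := by
      rw [(h.indepFun_waitSum j).map_prod_eq_prod_map_map hmW.aemeasurable
        (h.measurable_pair j).aemeasurable,
        (h.indep_position_wait j).map_prod_eq_prod_map_map (h.measurable_position j).aemeasurable
        (h.measurable_wait j).aemeasurable, (h.law_position j).map_eq, (h.law_wait j).map_eq]
    have hset : MeasurableSet {p : ℝ × (Circ × ℝ) | p.1 ≤ a ∧ b < p.1 + p.2.2 ∧ p.2.1 ∈ J} := by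
      refine (measurableSet_le measurable_fst measurable_const).inter
        ((measurableSet_lt measurable_const
        (measurable_fst.add measurable_snd.snd)).inter ?_)
      exact (measurable_snd.fst : Measurable fun p : ℝ × (Circ × ℝ) => p.2.1) hJ
    have e1 : P {ω | waitSum Y j ω ≤ a ∧ b < waitSum Y (j + 1) ω ∧ C j ω ∈ J} =
        P.map (fun ω => (waitSum Y j ω, (C j ω, Y j ω)))
          {p : ℝ × (Circ × ℝ) | p.1 ≤ a ∧ b < p.1 + p.2.2 ∧ p.2.1 ∈ J} := by
      rw [Measure.map_apply (hmW.prodMk (h.measurable_pair j)) hset]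
      simp only [Set.preimage_ofPred_eq, waitSum_succ]
    rw [e1, hlaw, Measure.prod_apply hset, ← lintegral_indicator measurableSet_Iic]
    refine lintegral_congr fun x => ?_
    by_cases hx : x ≤ a
    · rw [Set.indicator_of_mem (by exact hx), ← expMeasure_Ioi h.rate_pos (by linarith),
        ← Measure.prod_prod]
      congr 1
      ext p
      simp only [Set.mem_preimage, Set.mem_ofPred_eq, Set.mem_prod, Set.mem_Ioi]
      constructor
      · rintro ⟨_, h2, h3⟩; exact ⟨h3, by linarith⟩
      · rintro ⟨h2, h3⟩; exact ⟨hx, by linarith, h2⟩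
    · rw [Set.indicator_of_notMem (by exact hx)]
      convert measure_empty (μ := (volume : Measure Circ).prod (expMeasure r))
      ext p
      simp [hx]
  have e0 : currentAt Y a j =
      {ω | waitSum Y j ω ≤ a ∧ a < waitSum Y (j + 1) ω ∧ C j ω ∈ (Set.univ : Set Circ)} := by
    simp [currentAt]
  rw [key b hab J hJ, e0, key a le_rfl _ MeasurableSet.univ, ← lintegral_const_mul _ (by fun_prop)]
  refine lintegral_congr fun x => ?_
  rw [UnitAddCircle.measure_univ, one_mul, mul_assoc,
    ← ENNReal.ofReal_mul (Real.exp_nonneg _), ← Real.exp_add]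
  ring_nf

/-- The probability that the arc stands still during `[a, b]`, at a position in `J`. -/
lemma measure_not_run_le (h : IsPoissonArc P r C Y) {a b : ℝ} (ha : 0 ≤ a) (hab : a ≤ b)
    {J : Set Circ} (hJ : MeasurableSet J) :
    P {ω | ∃ j, waitSum Y j ω ≤ a ∧ b < waitSum Y (j + 1) ω ∧ C j ω ∈ J}ᶜ ≤
      1 - volume J * ENNReal.ofReal (Real.exp (-(r * (b - a)))) := by
  have := h.isProbabilityMeasure
  refine h.measure_le_of_currentAt ha fun j => ?_
  have hmW := measurable_waitSum h.measurable_wait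
  set R := {ω | waitSum Y j ω ≤ a ∧ b < waitSum Y (j + 1) ω ∧ C j ω ∈ J} with hR
  have hRm : MeasurableSet R := (measurableSet_le (hmW j) measurable_const).inter
    ((measurableSet_lt measurable_const (hmW _)).inter (h.measurable_position j hJ))
  have hsub : R ⊆ currentAt Y a j := fun ω hω => ⟨hω.1, hab.trans_lt hω.2.1⟩
  refine (measure_mono (t := currentAt Y a j \ R) ?_).trans (le_of_eq ?_)
  · rintro ω ⟨h1, h2⟩
    exact ⟨h1, fun hr => h2 ⟨j, hr⟩⟩
  · rw [measure_sdiff hsub hRm.nullMeasurableSet (measure_ne_top _ _), hR, h.measure_run hab hJ,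
      ENNReal.sub_mul (fun _ _ => measure_ne_top _ _), one_mul]

/-- Within a window of length `k * η + δ` the arc has, with high probability, a run of length `δ`
at a position in `G`. -/
lemma measure_not_run_in_window_le (h : IsPoissonArc P r C Y) {a η δ : ℝ} (ha : 0 ≤ a)
    (hη : 0 ≤ η) (hδ : 0 ≤ δ) {G : Set Circ} (hG : MeasurableSet G) (k : ℕ) :
    P {ω | ∃ j, C j ω ∈ G ∧ a ≤ waitSum Y j ω ∧ waitSum Y j ω ≤ a + k * η ∧ δ < Y j ω}ᶜ ≤
      (k + 1) * ENNReal.ofReal (Real.exp (-(r * η))) + k * ENNReal.ofReal (r * δ)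
        + (volume Gᶜ) ^ k := by
  have := h.isProbabilityMeasure
  refine h.measure_le_of_currentAt ha fun j => ?_
  have hmW := measurable_waitSum h.measurable_wait
  set E := currentAt Y a j with hE
  -- The interval `j` began before the window, so the candidates are the next `k` ones. They are
  -- independent of `E`, which involves only the waits up to index `j`.
  set F := Finset.Ico (j + 1) (j + 1 + k) with hF
  have hind : ∀ S : Set (F → Circ × ℝ), MeasurableSet S →
      P (E ∩ {ω | (fun i : F => (C i ω, Y i ω)) ∈ S}) =
        P {ω | (fun i : F => (C i ω, Y i ω)) ∈ S} * P E := by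
    intro S hS
    have h1 := h.indep.indepFun_finset (Finset.range (j + 1)) F
      (by rw [Finset.disjoint_left]; intro x; simp [hF]; omega) h.measurable_pair
    have hmc : ∀ n ≤ j + 1, Measurable (fun f : Finset.range (j + 1) → Circ × ℝ =>
        ∑ k : Finset.range (j + 1), if (k : ℕ) < n then (f k).2 else 0) := fun n _ =>
      Finset.measurable_fun_sum _ fun k _ => by
        split_ifs
        · exact (measurable_pi_apply k).snd
        · exact measurable_const
    have hval : ∀ n ≤ j + 1, ∀ ω, (∑ k : Finset.range (j + 1),
        if (k : ℕ) < n then (fun (i : Finset.range (j + 1)) => (C i ω, Y i ω)) k |>.2 else 0)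
          = waitSum Y n ω := by
      intro n hn ω
      rw [Finset.sum_coe_sort (Finset.range (j + 1)) (fun k => if k < n then Y k ω else 0),
        ← Finset.sum_filter, waitSum]
      congr 1
      ext x; simp; omega
    have hES := h1.measure_inter_preimage_eq_mul
      {f | (∑ k : Finset.range (j + 1), if (k : ℕ) < j then (f k).2 else 0) ≤ a ∧
        a < ∑ k : Finset.range (j + 1), if (k : ℕ) < j + 1 then (f k).2 else 0} S
      ((measurableSet_le (hmc j (by omega)) measurable_const).inter
        (measurableSet_lt measurable_const (hmc (j + 1) le_rfl))) hS
    have hEeq : (fun ω (i : Finset.range (j + 1)) => (C i ω, Y i ω)) ⁻¹'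
        {f | (∑ k : Finset.range (j + 1), if (k : ℕ) < j then (f k).2 else 0) ≤ a ∧
        a < ∑ k : Finset.range (j + 1), if (k : ℕ) < j + 1 then (f k).2 else 0} = E := by
      ext ω
      simp only [Set.mem_preimage, Set.mem_ofPred_eq]
      rw [hval j (by omega), hval (j + 1) le_rfl]
      rfl
    rw [hEeq, mul_comm] at hES
    exact hES
  have hgt : ∀ i ∈ F, P (E ∩ {ω | η < Y i ω}) = ENNReal.ofReal (Real.exp (-(r * η))) * P E := by
    intro i hi
    rw [← h.wait_gt i hη]
    exact hind {f | η < (f ⟨i, hi⟩).2}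
      (measurableSet_lt measurable_const (measurable_pi_apply _).snd)
  have hle : ∀ i ∈ F, P (E ∩ {ω | Y i ω ≤ δ}) ≤ ENNReal.ofReal (r * δ) * P E := by
    intro i hi
    refine le_trans (le_of_eq ?_) (mul_le_mul_left (h.wait_le i hδ) _)
    exact hind {f | (f ⟨i, hi⟩).2 ≤ δ}
      (measurableSet_le (measurable_pi_apply _).snd measurable_const)
  have hpos : P (E ∩ {ω | ∀ i ∈ F, C i ω ∉ G}) = (volume Gᶜ) ^ k * P E := by
    have e1 : P {ω | ∀ i ∈ F, C i ω ∉ G} = (volume Gᶜ) ^ k := by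
      have h2 := h.indep.measure_inter_preimage_eq_mul F (sets := fun _ => {p | p.1 ∈ Gᶜ})
        (fun i _ => measurable_fst hG.compl)
      have h3 : ∀ i, P ((fun ω => (C i ω, Y i ω)) ⁻¹' {p | p.1 ∈ Gᶜ}) = volume Gᶜ := by
        intro i
        rw [← (h.law_position i).map_eq, Measure.map_apply (h.measurable_position i) hG.compl]
        rfl
      rw [Finset.prod_congr rfl (fun i _ => h3 i), Finset.prod_const, hF, Nat.card_Ico,
        Nat.add_sub_cancel_left] at h2
      rw [← h2]
      congr 1
      ext ω; simp [hF]
    rw [← e1]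
    have := hind {f | ∀ i : F, (f i).1 ∈ Gᶜ} (by
      rw [Set.ofPred_forall]
      exact MeasurableSet.iInter fun i => (measurable_pi_apply i).fst hG.compl)
    simpa using this
  have hfirst : P (E ∩ {ω | a + η < waitSum Y (j + 1) ω}) =
      ENNReal.ofReal (Real.exp (-(r * η))) * P E := by
    have := h.measure_run (show a ≤ a + η by linarith) MeasurableSet.univ j
    rw [UnitAddCircle.measure_univ, one_mul,
      add_sub_cancel_left] at this
    rw [← this]
    congr 1
    ext ω
    simp only [hE, currentAt, Set.mem_inter_iff, Set.mem_ofPred_eq, Set.mem_univ, and_true]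
    constructor
    · rintro ⟨⟨h1, _⟩, h2⟩; exact ⟨h1, h2⟩
    · rintro ⟨h1, h2⟩; exact ⟨⟨h1, by linarith⟩, h2⟩
  have hcover : E ∩ {ω | ∃ j, C j ω ∈ G ∧ a ≤ waitSum Y j ω ∧ waitSum Y j ω ≤ a + k * η ∧
      δ < Y j ω}ᶜ ⊆ (((E ∩ {ω | a + η < waitSum Y (j + 1) ω}) ∪ ⋃ i ∈ F, E ∩ {ω | η < Y i ω}) ∪
        ⋃ i ∈ F, E ∩ {ω | Y i ω ≤ δ}) ∪ (E ∩ {ω | ∀ i ∈ F, C i ω ∉ G}) := by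
    rintro ω ⟨hω, hno⟩
    by_contra hcon
    simp only [Set.mem_union, Set.mem_iUnion, Set.mem_inter_iff, hω, true_and, not_or,
      Set.mem_ofPred_eq, not_exists, not_lt, not_le, not_forall, not_not] at hcon
    obtain ⟨⟨⟨h1, h2⟩, h3⟩, i, hi, hiG⟩ := hcon
    have hstep : ∀ m ≤ k, a ≤ waitSum Y (j + 1 + m) ω ∧
        waitSum Y (j + 1 + m) ω ≤ a + (m + 1) * η := by
      intro m hm
      induction m with
      | zero => exact ⟨hω.2.le, by simpa using h1⟩
      | succ m ih =>
        obtain ⟨ih1, ih2⟩ := ih (by omega)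
        have hmF : j + 1 + m ∈ F := by simp [hF]; omega
        have h5 := h2 _ hmF
        have h6 := h3 _ hmF
        rw [← add_assoc, waitSum_succ]
        push_cast
        constructor <;> linarith
    obtain ⟨m, rfl⟩ := Nat.exists_eq_add_of_le (Finset.mem_Ico.1 hi).1
    have hmk : m + 1 ≤ k := by have := (Finset.mem_Ico.1 hi).2; omega
    obtain ⟨h7, h8⟩ := hstep m (by omega)
    refine hno ⟨j + 1 + m, hiG, h7, h8.trans ?_, h3 _ hi⟩
    have : ((m : ℝ) + 1) ≤ k := by exact_mod_cast hmk
    gcongr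
  have hcard : F.card = k := by simp [hF]
  refine (measure_mono hcover).trans ((measure_union_le _ _).trans ?_)
  rw [hpos, add_mul]
  gcongr
  refine (measure_union_le _ _).trans ?_
  rw [add_mul]
  gcongr
  · refine (measure_union_le _ _).trans ?_
    rw [hfirst, add_mul, one_mul, add_mul, add_comm]
    gcongr
    refine (measure_biUnion_finset_le _ _).trans ?_
    rw [Finset.sum_congr rfl hgt, Finset.sum_const, hcard, nsmul_eq_mul, mul_assoc]
  · refine (measure_biUnion_finset_le _ _).trans ((Finset.sum_le_sum hle).trans ?_)
    rw [Finset.sum_const, hcard, nsmul_eq_mul, mul_assoc]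

end IsPoissonArc

/-! ### Density from accumulation of centers -/

/-- By Baire's theorem, `E_t` is dense as soon as every small ball around a point of a dense set
contains infinitely many centers. -/
lemma dense_coveredIO {ℓ : ℕ → ℝ} (hℓ : ∀ n, 0 < ℓ n) {u : ℕ → ℝ≥0 → Circ} {t : ℝ≥0}
    {D : Set Circ} (hD : Dense D)
    (h : ∀ x ∈ D, ∀ q : ℕ, ∃ᶠ n in atTop, u n t ∈ Metric.closedBall x (1 / ((q : ℝ) + 1))) :
    Dense (coveredIO ℓ u t) := by
  have hopen : ∀ n, IsOpen (openArc (u n t) (ℓ n)) := fun n => Metric.isOpen_ball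
  rw [coveredIO, limsup_eq_iInf_iSup_of_nat]
  refine dense_iInter_of_isOpen (fun N => isOpen_biUnion fun n _ => hopen n) fun N => ?_
  rw [Metric.dense_iff]
  intro y ε hε
  obtain ⟨x, hxD, hx⟩ := Metric.dense_iff.1 hD y (ε / 2) (by linarith) |>.imp fun x hx => hx.symm
  obtain ⟨q, hq⟩ := exists_nat_one_div_lt (show (0 : ℝ) < ε / 2 by linarith)
  obtain ⟨n, hn, hun⟩ := (h x hxD q).forall_exists_of_atTop N
  refine ⟨u n t, ?_, Set.mem_biUnion hn (Metric.mem_ball_self (half_pos (hℓ n)))⟩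
  rw [Metric.mem_closedBall] at hun
  rw [Metric.mem_ball] at hx ⊢
  linarith [dist_triangle (u n t) x y]

lemma volume_closedBall_pos (x : Circ) {ε : ℝ} (hε : 0 < ε) :
    0 < volume (Metric.closedBall x ε) := by
  rw [AddCircle.volume_closedBall, ENNReal.ofReal_pos]
  exact lt_min one_pos (by linarith)

/-- To prove that there are almost surely no exceptional times, one can treat the balls around
which the centers could fail to accumulate one at a time. -/
lemma ae_nonDenseTimes_eq_empty {Ω : Type*} [MeasurableSpace Ω] {P : Measure Ω} {ℓ : ℕ → ℝ}
    (hℓ : ∀ n, 0 < ℓ n) {u : Ω → ℕ → ℝ≥0 → Circ}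
    (h : ∀ (x : Circ) (ε : ℝ), 0 < ε → ∀ᵐ ω ∂P, ∀ t ∈ Set.Icc (0 : ℝ≥0) 1,
      ∃ᶠ n in atTop, u ω n t ∈ Metric.closedBall x ε) :
    ∀ᵐ ω ∂P, nonDenseTimes ℓ (u ω) = ∅ := by
  obtain ⟨D, hDc, hD⟩ := TopologicalSpace.exists_countable_dense Circ
  have h1 : ∀ᵐ ω ∂P, ∀ x ∈ D, ∀ q : ℕ, ∀ t ∈ Set.Icc (0 : ℝ≥0) 1,
      ∃ᶠ n in atTop, u ω n t ∈ Metric.closedBall x (1 / ((q : ℝ) + 1)) := by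
    rw [ae_ball_iff hDc]
    intro x _
    rw [ae_all_iff]
    exact fun q => h x _ Nat.one_div_pos_of_nat
  filter_upwards [h1] with ω hω
  rw [Set.eq_empty_iff_forall_notMem]
  rintro t ⟨ht, hnd⟩
  exact hnd (dense_coveredIO hℓ hD fun x hx q => hω x hx q t ht)

/-! ### The Brownian model -/

/-- A standard Brownian motion has the same law as any other, as a random element of the space of
all paths with the product `σ`-algebra. -/
lemma isProjectiveLimit_map_brownian {Ω : Type*} [MeasurableSpace Ω] {P : Measure Ω}
    {B : ℝ≥0 → Ω → ℝ} (h : IsBrownianReal B P) (hm : ∀ t, Measurable (B t)) :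
    IsProjectiveLimit (P.map fun ω t => B t ω) BrownianReal.projectiveFamily := by
  intro I
  rw [Measure.map_map (Finset.measurable_restrict I) (measurable_pi_lambda _ hm)]
  exact (h.hasLaw I).map_eq

namespace IsBrownianModel

variable {Ω : Type*} [MeasurableSpace Ω] {P : Measure Ω} {V : ℕ → Ω → Circ}
  {B : ℕ → ℝ≥0 → Ω → ℝ}

lemma measurable_pair (h : IsBrownianModel P V B) (i : ℕ) :
    Measurable (fun ω => (V i ω, fun t : ℝ≥0 => B i t ω)) :=
  (h.measurable_start i).prodMk (measurable_pi_lambda _ (h.measurable_motion i))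

lemma map_pair_eq [IsProbabilityMeasure P] (h : IsBrownianModel P V B) (i j : ℕ) :
    P.map (fun ω => (V i ω, fun t : ℝ≥0 => B i t ω)) =
      P.map (fun ω => (V j ω, fun t : ℝ≥0 => B j t ω)) := by
  have hm : ∀ i, Measurable (fun ω (t : ℝ≥0) => B i t ω) := fun i =>
    measurable_pi_lambda _ (h.measurable_motion i)
  have key : P.map (fun ω (t : ℝ≥0) => B i t ω) = P.map (fun ω (t : ℝ≥0) => B j t ω) :=
    IsProjectiveLimit.unique
      (isProjectiveLimit_map_brownian (h.brownian i) (h.measurable_motion i))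
      (isProjectiveLimit_map_brownian (h.brownian j) (h.measurable_motion j))
  rw [(h.indep_start_motion i).map_prod_eq_prod_map_map (h.measurable_start i).aemeasurable
      (hm i).aemeasurable,
    (h.indep_start_motion j).map_prod_eq_prod_map_map (h.measurable_start j).aemeasurable
      (hm j).aemeasurable, (h.law_start i).map_eq, (h.law_start j).map_eq, key]

/-- Given the Brownian motion, the center is a translate of a uniform point, hence uniform. -/
lemma measure_center_mem [IsProbabilityMeasure P] (h : IsBrownianModel P V B) (i : ℕ) (t : ℝ≥0)
    {J : Set Circ} (hJ : MeasurableSet J) :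
    P {ω | V i ω + ((B i t ω : ℝ) : Circ) ∈ J} = volume J := by
  have hcoe : Measurable (fun x : ℝ => (x : Circ)) := (AddCircle.continuous_mk' 1).measurable
  have hmt := h.measurable_motion i t
  have : IsProbabilityMeasure (P.map (B i t)) := Measure.isProbabilityMeasure_map hmt.aemeasurable
  have hind : IndepFun (V i) (B i t) P :=
    (h.indep_start_motion i).comp measurable_id (measurable_pi_apply t)
  have hset : MeasurableSet {p : Circ × ℝ | p.1 + (p.2 : Circ) ∈ J} :=
    (measurable_fst.add (hcoe.comp measurable_snd)) hJ
  have e1 : P {ω | V i ω + ((B i t ω : ℝ) : Circ) ∈ J} =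
      P.map (fun ω => (V i ω, B i t ω)) {p : Circ × ℝ | p.1 + (p.2 : Circ) ∈ J} := by
    rw [Measure.map_apply ((h.measurable_start i).prodMk hmt) hset]
    rfl
  rw [e1, hind.map_prod_eq_prod_map_map (h.measurable_start i).aemeasurable hmt.aemeasurable,
    (h.law_start i).map_eq, Measure.prod_apply_symm hset]
  have : ∀ y : ℝ, volume ((fun x : Circ => (x, y)) ⁻¹' {p : Circ × ℝ | p.1 + (p.2 : Circ) ∈ J}) =
      volume J := fun y => measure_preimage_add_right volume (y : Circ) J
  simp_rw [this]
  rw [lintegral_const, measure_univ, mul_one]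

/-- Around each time there is an interval during which infinitely many centers stay in a given
ball. -/
lemma exists_frequently_mem [IsProbabilityMeasure P] (h : IsBrownianModel P V B) (x : Circ)
    {ε : ℝ} (hε : 0 < ε) (t₀ : ℝ≥0) :
    ∃ U ∈ 𝓝 t₀, ∀ᵐ ω ∂P, ∀ t ∈ U, ∃ᶠ n in atTop,
      brownianCenter V B ω n t ∈ Metric.closedBall x ε := by
  have hcoe : Continuous (fun x : ℝ => (x : Circ)) := AddCircle.continuous_mk' 1
  obtain ⟨D, hDc, hD⟩ := TopologicalSpace.exists_countable_dense ℝ≥0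
  let W : ℕ → Set ℝ≥0 := fun m => Metric.ball t₀ (1 / ((m : ℝ) + 1))
  -- Only times in a countable dense set are imposed, which keeps the event measurable in the
  -- product `σ`-algebra; continuity of paths and closedness of the ball recover the other times of
  -- `W m`.
  let S : ℕ → Set (Circ × (ℝ≥0 → ℝ)) := fun m =>
    ⋂ s ∈ W m ∩ D, {p | p.1 + ((p.2 s : ℝ) : Circ) ∈ Metric.closedBall x ε}
  have hSm : ∀ m, MeasurableSet (S m) := fun m =>
    MeasurableSet.biInter (hDc.mono Set.inter_subset_right) fun s _ =>
      (measurable_fst.add (hcoe.measurable.comp ((measurable_pi_apply s).comp measurable_snd)))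
        Metric.isClosed_closedBall.measurableSet
  let Z : ℕ → Ω → Circ × (ℝ≥0 → ℝ) := fun i ω => (V i ω, fun t => B i t ω)
  have hZ : ∀ i, Measurable (Z i) := h.measurable_pair
  obtain ⟨m, hm⟩ : ∃ m, P (Z 0 ⁻¹' S m) ≠ 0 := by
    by_contra! hzero
    have hpos : 0 < volume (Metric.closedBall x (ε / 2)) := volume_closedBall_pos x (half_pos hε)
    rw [← h.measure_center_mem 0 t₀ Metric.isClosed_closedBall.measurableSet] at hpos
    refine hpos.ne' (measure_mono_null_ae ?_ (measure_iUnion_null hzero))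
    filter_upwards [(h.brownian 0).cont] with ω hc hω
    have hcont : Continuous fun t => V 0 ω + ((B 0 t ω : ℝ) : Circ) :=
      continuous_const.add (hcoe.comp hc)
    have hnb : ∀ᶠ t in 𝓝 t₀, V 0 ω + ((B 0 t ω : ℝ) : Circ) ∈ Metric.ball x ε :=
      hcont.continuousAt.eventually_mem (Metric.isOpen_ball.mem_nhds
        (Metric.closedBall_subset_ball (half_lt_self hε) hω))
    obtain ⟨δ, hδ, hδ'⟩ := Metric.eventually_nhds_iff_ball.1 hnb
    obtain ⟨m, hm⟩ := exists_nat_one_div_lt hδ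
    refine Set.mem_iUnion.2 ⟨m, Set.mem_iInter₂.2 fun s hs => ?_⟩
    exact Metric.ball_subset_closedBall (hδ' s (Metric.ball_subset_ball hm.le hs.1))
  refine ⟨W m, Metric.ball_mem_nhds _ Nat.one_div_pos_of_nat, ?_⟩
  have hAm : ∀ i, MeasurableSet (Z i ⁻¹' S m) := fun i => hZ i (hSm m)
  have hAP : ∀ i, P (Z i ⁻¹' S m) = P (Z 0 ⁻¹' S m) := fun i => by
    rw [← Measure.map_apply (hZ i) (hSm m), ← Measure.map_apply (hZ 0) (hSm m)]
    exact congrArg (· (S m)) (h.map_pair_eq i 0)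
  have hind : iIndepSet (fun i => Z i ⁻¹' S m) P := by
    rw [iIndepSet_iff_meas_biInter hAm]
    intro s
    exact h.indep.measure_inter_preimage_eq_mul s (sets := fun _ => S m) fun _ _ => hSm m
  have hsum : (∑' i, P (Z i ⁻¹' S m)) = ∞ := by
    simp_rw [hAP]
    exact ENNReal.tsum_const_eq_top_of_ne_zero hm
  have h1 := measure_limsup_eq_one hAm hind hsum
  rw [← prob_compl_eq_zero_iff (MeasurableSet.measurableSet_limsup hAm)] at h1
  filter_upwards [show ∀ᵐ ω ∂P, ω ∈ limsup (fun i => Z i ⁻¹' S m) atTop from h1,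
    ae_all_iff.2 fun i => (h.brownian i).cont] with ω hω hc t ht
  rw [mem_limsup_iff_frequently_mem] at hω
  refine hω.mono fun i hi => ?_
  have hcont : Continuous fun t => V i ω + ((B i t ω : ℝ) : Circ) :=
    continuous_const.add (hcoe.comp (hc i))
  have hcl : IsClosed {t | V i ω + ((B i t ω : ℝ) : Circ) ∈ Metric.closedBall x ε} :=
    Metric.isClosed_closedBall.preimage hcont
  have hsub : W m ∩ D ⊆ {t | V i ω + ((B i t ω : ℝ) : Circ) ∈ Metric.closedBall x ε} :=
    fun s hs => Set.mem_iInter₂.1 hi s hs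
  exact closure_minimal hsub hcl (hD.open_subset_closure_inter Metric.isOpen_ball ht)

lemma ae_nonDenseTimes_eq_empty [IsProbabilityMeasure P] (h : IsBrownianModel P V B) {ℓ : ℕ → ℝ}
    (hℓ : ∀ n, 0 < ℓ n) : ∀ᵐ ω ∂P, nonDenseTimes ℓ (brownianCenter V B ω) = ∅ := by
  refine _root_.ae_nonDenseTimes_eq_empty hℓ fun x ε hε => ?_
  choose U hU hae using h.exists_frequently_mem x hε
  obtain ⟨s, hs, hcov⟩ := TopologicalSpace.countable_cover_nhds hU
  have h1 := (ae_ball_iff hs).2 fun t₀ _ => hae t₀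
  filter_upwards [h1] with ω hω t _
  obtain ⟨t₀, ht₀, htU⟩ := Set.mem_iUnion₂.1 (hcov.ge (Set.mem_univ t))
  exact hω t₀ ht₀ t htU

end IsBrownianModel

/-! ### The Poisson model with polynomially bounded rates -/

lemma poissonCenter_eq {Ω : Type*} {C : ℕ → ℕ → Ω → Circ} {Y : ℕ → ℕ → Ω → ℝ} {ω : Ω} {i j : ℕ}
    {t : ℝ≥0} (hY : ∀ j, 0 ≤ Y i j ω) (ht : ω ∈ currentAt (Y i) t j) :
    poissonCenter C Y ω i t = C i j ω := by
  rw [poissonCenter, tsum_eq_single j]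
  · exact Set.indicator_of_mem (s := Set.Ico _ _) ht _
  · intro j' hj'
    exact Set.indicator_of_notMem (s := Set.Ico _ _)
      (fun h => hj' (index_unique_of_mem hY h ht)) _

/-- The trajectories of one arc which stand still during `[a, b]`, at a position in `J`. -/
def runSet (J : Set Circ) (a b : ℝ) : Set (ℕ → Circ × ℝ) :=
  {f | ∃ j, ∑ k ∈ Finset.range j, (f k).2 ≤ a ∧ b < ∑ k ∈ Finset.range (j + 1), (f k).2 ∧
    (f j).1 ∈ J}

lemma measurableSet_runSet {J : Set Circ} (hJ : MeasurableSet J) (a b : ℝ) :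
    MeasurableSet (runSet J a b) := by
  have hs : ∀ j, Measurable fun f : ℕ → Circ × ℝ => ∑ k ∈ Finset.range j, (f k).2 := fun j =>
    Finset.measurable_fun_sum _ fun k _ => (measurable_pi_apply k).snd
  rw [runSet, Set.ofPred_exists]
  exact MeasurableSet.iUnion fun j => (measurableSet_le (hs j) measurable_const).inter
    ((measurableSet_lt measurable_const (hs _)).inter ((measurable_pi_apply j).fst hJ))

namespace IsPoissonModel

variable {Ω : Type*} [MeasurableSpace Ω] {P : Measure Ω} {α : ℝ} {ℓ : ℕ → ℝ}
  {C : ℕ → ℕ → Ω → Circ} {Y : ℕ → ℕ → Ω → ℝ}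

/-- Currying an infinite product measure gives a product of products. Whole trajectories are needed
since `runSet` depends on the entire row. -/
lemma iIndepFun_rows (h : IsPoissonModel P α ℓ C Y) :
    iIndepFun (fun i ω (j : ℕ) => (C i j ω, Y i j ω)) P := by
  have := h.indep.isProbabilityMeasure
  have hm : ∀ i j, Measurable (fun ω => (C i j ω, Y i j ω)) := fun i j =>
    (h.measurable_position i j).prodMk (h.measurable_wait i j)
  have hp : ∀ i j, IsProbabilityMeasure (P.map (fun ω => (C i j ω, Y i j ω))) := fun i j =>
    Measure.isProbabilityMeasure_map (hm i j).aemeasurable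
  have hrow : ∀ i, iIndepFun (fun j ω => (C i j ω, Y i j ω)) P := fun i =>
    h.indep.precomp (g := fun j => (i, j)) (fun a b hab => by simpa using hab)
  have hmr : ∀ i, Measurable (fun ω (j : ℕ) => (C i j ω, Y i j ω)) := fun i =>
    measurable_pi_lambda _ (hm i)
  rw [iIndepFun_iff_map_fun_eq_infinitePi_map hmr]
  have h1 := (iIndepFun_iff_map_fun_eq_infinitePi_map (fun p : ℕ × ℕ => hm p.1 p.2)).1 h.indep
  have h2 : P.map (fun ω i j => (C i j ω, Y i j ω)) =
      (P.map (fun ω (p : ℕ × ℕ) => (C p.1 p.2 ω, Y p.1 p.2 ω))).map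
        (MeasurableEquiv.curry ℕ ℕ (Circ × ℝ)) := by
    rw [Measure.map_map (MeasurableEquiv.measurable _)
      (measurable_pi_lambda _ fun p : ℕ × ℕ => hm p.1 p.2)]
    rfl
  rw [h2, h1, Measure.infinitePi_map_curry (fun i j => P.map (fun ω => (C i j ω, Y i j ω)))]
  congr 1
  ext1 i
  exact ((iIndepFun_iff_map_fun_eq_infinitePi_map (hm i)).1 (hrow i)).symm

lemma ae_frequently_mem [IsProbabilityMeasure P] (h : IsPoissonModel P α ℓ C Y)
    (hℓ : ∀ n, 0 < ℓ n) {K : ℕ} (hK : ∀ n, ℓ n ^ (-α) ≤ ((n : ℝ) + 1) ^ K)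
    (x : Circ) {ε : ℝ} (hε : 0 < ε) :
    ∀ᵐ ω ∂P, ∀ t ∈ Set.Icc (0 : ℝ≥0) 1, ∃ᶠ n in atTop,
      poissonCenter C Y ω n t ∈ Metric.closedBall x ε := by
  set J := Metric.closedBall x ε
  have hJ : MeasurableSet J := Metric.isClosed_closedBall.measurableSet
  set p : ℝ≥0∞ := volume J * ENNReal.ofReal (Real.exp (-1)) with hp
  have hp0 : p ≠ 0 := by
    rw [hp]
    exact mul_ne_zero (volume_closedBall_pos x hε).ne' (by simp [Real.exp_pos])
  set q : ℝ := (1 - p).toReal with hq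
  have hq1 : q < 1 := by
    rw [hq, ← ENNReal.toReal_one]
    exact (ENNReal.toReal_lt_toReal (by simp) (by simp)).2
      (ENNReal.sub_lt_self (by simp) (by simp) hp0)
  have hpq : 1 - p = ENNReal.ofReal q := (ENNReal.ofReal_toReal (by simp)).symm
  have hq0 : 0 ≤ q := ENNReal.toReal_nonneg
  have hpos : ∀ᵐ ω ∂P, ∀ i j, 0 < Y i j ω := ae_all_iff.2 fun i => (h.arc hℓ i).ae_wait_pos
  have key : ∀ N : ℕ, P {ω | ∃ t ∈ Set.Icc (0 : ℝ≥0) 1, ∀ n ≥ N,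
      poissonCenter C Y ω n t ∉ J} = 0 := by
    intro N
    have hbound : ∀ M : ℕ, 1 ≤ M → P {ω | ∃ t ∈ Set.Icc (0 : ℝ≥0) 1, ∀ n ≥ N,
        poissonCenter C Y ω n t ∉ J} ≤
          ENNReal.ofReal (((N : ℝ) + 1) ^ K * ((M : ℝ) ^ K * q ^ M) + q ^ M) := by
      intro M hM
      -- For `n < N + M` one has `n + 1 ≤ (N + 1) * M`, so every rate in play is at most `m`; an arc
      -- then makes no update in a cell of length `1 / m` with probability at least `exp (-1)`.
      set m : ℕ := ((N + 1) * M) ^ K with hm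
      have hm0 : 0 < m := by positivity
      have hmR : (0 : ℝ) < m := by exact_mod_cast hm0
      let F := Finset.Ico N (N + M)
      let A : ℕ → Set Ω := fun k => ⋂ n ∈ F,
        (fun ω (j : ℕ) => (C n j ω, Y n j ω)) ⁻¹' (runSet J (k / m) ((k + 1) / m))ᶜ
      have hA : ∀ k, P (A k) ≤ ENNReal.ofReal (q ^ M) := by
        intro k
        have h1 := h.iIndepFun_rows.measure_inter_preimage_eq_mul F
          (sets := fun _ => (runSet J (k / m) ((k + 1) / m))ᶜ)
          (fun n _ => (measurableSet_runSet hJ _ _).compl)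
        rw [h1, ENNReal.ofReal_pow hq0, ← hpq,
          show M = F.card by simp [F], ← Finset.prod_const]
        refine Finset.prod_le_prod' fun n hn => ?_
        have hn' : n < N + M := (Finset.mem_Ico.1 hn).2
        have h2 := (h.arc hℓ n).measure_not_run_le (a := k / m) (b := (k + 1) / m)
          (by positivity) (by gcongr; linarith) hJ
        refine le_trans ?_ (h2.trans ?_)
        · rfl
        · refine tsub_le_tsub_left ?_ 1
          rw [hp]
          gcongr
          have h3 : ((k : ℝ) + 1) / m - k / m = 1 / m := by ring
          have h4 : ℓ n ^ (-α) ≤ m := by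
            refine (hK n).trans ?_
            rw [hm]
            push_cast
            gcongr
            have : n + 1 ≤ (N + 1) * M := by nlinarith
            exact_mod_cast this
          rw [h3, mul_one_div]
          exact (div_le_one hmR).2 h4
      -- A bad time lies in the cell with index `⌊t * m⌋`; the time `t = 1` requires the extra index
      -- `m`.
      calc _ ≤ P (⋃ k ∈ Finset.range (m + 1), A k) := by
            apply measure_mono_ae
            filter_upwards [hpos] with ω hω hbad
            obtain ⟨t, ht, htn⟩ := hbad
            have htm : (0 : ℝ) ≤ t * m := by positivity
            have hfl := Nat.floor_le htm
            have hfl' := Nat.lt_floor_add_one ((t : ℝ) * m)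
            have ht1 : (t : ℝ) ≤ 1 := by exact_mod_cast ht.2
            refine Set.mem_iUnion₂.2 ⟨⌊(t : ℝ) * m⌋₊, ?_, Set.mem_iInter₂.2 fun n hn hrun => ?_⟩
            · rw [Finset.mem_range, Nat.lt_succ_iff]
              have : (⌊(t : ℝ) * m⌋₊ : ℝ) ≤ m := by nlinarith
              exact_mod_cast this
            · obtain ⟨j, hj1, hj2, hj3⟩ := hrun
              refine htn n (Finset.mem_Ico.1 hn).1 ?_
              rw [poissonCenter_eq (j := j) (fun j => (hω n j).le)]
              · exact hj3
              · exact ⟨hj1.trans ((div_le_iff₀ hmR).2 hfl),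
                  ((lt_div_iff₀ hmR).2 hfl').trans hj2⟩
        _ ≤ ∑ k ∈ Finset.range (m + 1), P (A k) := measure_biUnion_finset_le _ _
        _ ≤ ∑ k ∈ Finset.range (m + 1), ENNReal.ofReal (q ^ M) :=
            Finset.sum_le_sum fun k _ => hA k
        _ = _ := by
            rw [Finset.sum_const, Finset.card_range, nsmul_eq_mul, ← ENNReal.ofReal_natCast,
              ← ENNReal.ofReal_mul (by positivity), hm]
            congr 1
            push_cast
            rw [mul_pow]
            ring
    have hlim : Tendsto (fun M : ℕ => ((N : ℝ) + 1) ^ K * ((M : ℝ) ^ K * q ^ M) + q ^ M) atTop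
        (𝓝 0) := by
      have hq' : |q| < 1 := by rwa [abs_of_nonneg hq0]
      simpa using ((tendsto_pow_const_mul_const_pow_of_abs_lt_one K hq').const_mul
        (((N : ℝ) + 1) ^ K)).add (tendsto_pow_atTop_nhds_zero_of_abs_lt_one hq')
    have hlim' := ENNReal.tendsto_ofReal hlim
    rw [ENNReal.ofReal_zero] at hlim'
    exact le_antisymm (ge_of_tendsto hlim' (eventually_atTop.2 ⟨1, hbound⟩)) zero_le
  have h2 : ∀ᵐ ω ∂P, ∀ N : ℕ, ¬ ∃ t ∈ Set.Icc (0 : ℝ≥0) 1, ∀ n ≥ N,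
      poissonCenter C Y ω n t ∉ J := by
    rw [ae_all_iff]
    intro N
    rw [ae_iff]
    simpa only [not_not] using key N
  filter_upwards [h2] with ω hω t ht
  rw [frequently_atTop]
  intro N
  by_contra hcon
  push Not at hcon
  exact hω N ⟨t, ht, hcon⟩

lemma ae_nonDenseTimes_eq_empty [IsProbabilityMeasure P] (h : IsPoissonModel P α ℓ C Y)
    (hℓ : ∀ n, 0 < ℓ n) {K : ℕ} (hK : ∀ n, ℓ n ^ (-α) ≤ ((n : ℝ) + 1) ^ K) :
    ∀ᵐ ω ∂P, nonDenseTimes ℓ (poissonCenter C Y ω) = ∅ :=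
  _root_.ae_nonDenseTimes_eq_empty hℓ fun x _ hε => h.ae_frequently_mem hℓ hK x hε

end IsPoissonModel

/-- Polynomially bounded lengths, or `α = 0`, give polynomially bounded update rates. -/
lemma exists_rate_le_pow {α : ℝ} {ℓ : ℕ → ℝ}
    (h : (0 < α ∧ ∃ c : ℝ, ∀ n : ℕ, ((n : ℝ) + 1) ^ (-c) ≤ ℓ n) ∨ α = 0) :
    ∃ K : ℕ, ∀ n : ℕ, ℓ n ^ (-α) ≤ ((n : ℝ) + 1) ^ K := by
  rcases h with ⟨hα, c, hc⟩ | rfl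
  · obtain ⟨K, hK⟩ := exists_nat_ge (c * α)
    refine ⟨K, fun n => ?_⟩
    have hn : (0 : ℝ) < (n : ℝ) + 1 := by positivity
    calc ℓ n ^ (-α) ≤ (((n : ℝ) + 1) ^ (-c)) ^ (-α) :=
          Real.rpow_le_rpow_of_nonpos (Real.rpow_pos_of_pos hn _) (hc n) (by linarith)
      _ = ((n : ℝ) + 1) ^ (c * α) := by rw [← Real.rpow_mul hn.le]; ring_nf
      _ ≤ ((n : ℝ) + 1) ^ (K : ℝ) :=
          Real.rpow_le_rpow_of_exponent_le (by linarith [(Nat.cast_nonneg n : (0 : ℝ) ≤ n)]) hK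
      _ = _ := Real.rpow_natCast _ _
  · exact ⟨0, fun n => by simp⟩

/-! ### Exceptional times in the Poisson model -/

lemma volume_compl_closedBall_eighth (x : Circ) :
    volume (Metric.closedBall x (1 / 8))ᶜ = ENNReal.ofReal (3 / 4) := by
  rw [measure_compl Metric.isClosed_closedBall.measurableSet (measure_ne_top _ _),
    UnitAddCircle.measure_univ, AddCircle.volume_closedBall, ← ENNReal.ofReal_one,
    ← ENNReal.ofReal_sub _ (by positivity)]
  norm_num

lemma norm_coe_half : ‖((1 / 2 : ℝ) : Circ)‖ = 1 / 2 := by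
  have h := AddCircle.norm_half_period_eq (p := (1 : ℝ))
  rwa [abs_one] at h

/-- If from some index on all centers are close to the point opposite to `0`, then no short arcs
reach a neighbourhood of `0`. -/
lemma not_dense_coveredIO {ℓ : ℕ → ℝ} (hℓ : ∀ n, ℓ n ≤ 1 / 2) {u : ℕ → ℝ≥0 → Circ} {t : ℝ≥0}
    {N : ℕ} (h : ∀ n ≥ N, u n t ∈ Metric.closedBall ((1 / 2 : ℝ) : Circ) (1 / 8)) :
    ¬ Dense (coveredIO ℓ u t) := by
  intro hd
  obtain ⟨z, hz0, hz⟩ := Metric.dense_iff.1 hd 0 (1 / 8) (by norm_num)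
  rw [coveredIO, mem_limsup_iff_frequently_mem] at hz
  obtain ⟨n, hn, hzn⟩ := hz.forall_exists_of_atTop N
  rw [Metric.mem_ball] at hz0
  rw [openArc, Metric.mem_ball] at hzn
  have h1 := h n hn
  rw [Metric.mem_closedBall] at h1
  have h2 : dist ((1 / 2 : ℝ) : Circ) 0 = 1 / 2 := by rw [dist_zero_right, norm_coe_half]
  have h3 := dist_triangle ((1 / 2 : ℝ) : Circ) z 0
  have h4 := dist_triangle ((1 / 2 : ℝ) : Circ) (u n t) z
  rw [dist_comm _ (u n t), dist_comm (u n t) z] at h4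
  -- The distance `1 / 2` would be strictly less than `1 / 8 + ℓ n / 2 + 1 / 8`, which is at most `1
  -- / 2`.
  linarith [hℓ n]

/-- The relation between the length `ℓ` of an arc, the length `h` of the time windows and the
length `δ` of the runs which the arc is to have within each window with probability `1 - ε`. -/
def IsRunScale (α ε h ℓ δ : ℝ) : Prop :=
  ∃ (k : ℕ) (η : ℝ), 0 ≤ η ∧ k * η + δ ≤ h / 2 ∧
    (2 / h + 2) * ((k + 1) * Real.exp (-(ℓ ^ (-α) * η)) + k * (ℓ ^ (-α) * δ) + (3 / 4) ^ k) ≤ ε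

/-- The order of choices matters: `k` makes the chance of missing the target small, `η` fits `k`
waits into `h / 4`, a short length makes the rate so large that waits beyond `η` are rare, and
finally `δ` is small compared with the typical wait. Each of the three error terms gets a third of
`ε`. -/
lemma exists_isRunScale {α ε h b : ℝ} (hα : 0 < α) (hε : 0 < ε) (hh : 0 < h) (hb : 0 < b) :
    ∃ ℓ δ : ℝ, 0 < ℓ ∧ ℓ < b ∧ 0 < δ ∧ δ ≤ h ∧ IsRunScale α ε h ℓ δ := by
  set A := 2 / h + 2 with hA
  have hA0 : 0 < A := by positivity
  set e := ε / (3 * A) with he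
  have he0 : 0 < e := by positivity
  obtain ⟨k, hk⟩ := exists_pow_lt_of_lt_one he0 (show (3 / 4 : ℝ) < 1 by norm_num)
  set η := h / (4 * (k + 1)) with hη
  have hη0 : 0 < η := by positivity
  have hlim : Tendsto (fun ℓ : ℝ => ((k : ℝ) + 1) * Real.exp (-(ℓ ^ (-α) * η))) (𝓝[>] 0) (𝓝 0) := by
    have h1 : Tendsto (fun ℓ : ℝ => ℓ ^ (-α)) (𝓝[>] 0) atTop :=
      tendsto_rpow_neg_nhdsGT_zero (by linarith)
    have h2 := Real.tendsto_exp_neg_atTop_nhds_zero.comp (h1.atTop_mul_const hη0)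
    simpa using h2.const_mul ((k : ℝ) + 1)
  obtain ⟨ℓ, hℓe, hℓ0, hℓb⟩ :=
    ((hlim.eventually_le_const he0).and (Ioo_mem_nhdsGT hb)).exists
  have hr : 0 < ℓ ^ (-α) := Real.rpow_pos_of_pos hℓ0 _
  refine ⟨ℓ, min (h / 4) (e / ((k + 1) * ℓ ^ (-α))), hℓ0, hℓb, by positivity,
    (min_le_left _ _).trans (by linarith), k, η, hη0.le, ?_, ?_⟩
  · have h1 : k * η ≤ h / 4 := by
      rw [hη, mul_div_assoc', div_le_div_iff₀ (by positivity) (by norm_num)]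
      nlinarith
    linarith [min_le_left (h / 4) (e / ((k + 1) * ℓ ^ (-α)))]
  · have h1 : k * (ℓ ^ (-α) * min (h / 4) (e / ((k + 1) * ℓ ^ (-α)))) ≤ e := by
      calc _ ≤ (k + 1) * (ℓ ^ (-α) * (e / ((k + 1) * ℓ ^ (-α)))) := by
            gcongr
            · linarith
            · exact min_le_right _ _
        _ = e := by field_simp
    calc _ ≤ A * (e + e + e) := by gcongr
      _ = ε := by rw [he]; field_simp; norm_num

lemma exists_runScale_seq {α : ℝ} (hα : 0 < α) :
    ∃ ℓ h : ℕ → ℝ, (∀ n, 0 < ℓ n) ∧ StrictAnti ℓ ∧ (∀ n, ℓ n ≤ (1 / 2) ^ (n + 1)) ∧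
      (∀ n, 0 < h n) ∧ (∀ n, h n ≤ 1) ∧
      ∀ n, IsRunScale α ((1 / 2) ^ n) (h n) (ℓ n) (h (n + 1)) := by
  have hex : ∀ (n : ℕ) (s : {p : ℝ × ℝ // 0 < p.1 ∧ 0 < p.2}),
      ∃ s' : {p : ℝ × ℝ // 0 < p.1 ∧ 0 < p.2}, s'.1.1 < s.1.1 ∧ s'.1.1 ≤ (1 / 2) ^ (n + 1) ∧
        s'.1.2 ≤ s.1.2 ∧ IsRunScale α ((1 / 2) ^ n) s.1.2 s'.1.1 s'.1.2 := by
    rintro n ⟨⟨ℓ, h⟩, hℓ, hh⟩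
    obtain ⟨ℓ', δ, h1, h2, h3, h4, h5⟩ := exists_isRunScale (α := α) (ε := (1 / 2) ^ n) (h := h)
      (b := min ℓ ((1 / 2) ^ (n + 1))) hα (by positivity) hh (lt_min hℓ (by positivity))
    exact ⟨⟨(ℓ', δ), h1, h3⟩, h2.trans_le (min_le_left _ _), (h2.trans_le (min_le_right _ _)).le,
      h4, h5⟩
  choose f hf using hex
  -- State `n + 1` pairs the length `ℓ n` with the run length `h (n + 1)`; the length in the seed
  -- serves only as an upper bound.
  let s : ℕ → {p : ℝ × ℝ // 0 < p.1 ∧ 0 < p.2} := fun n =>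
    Nat.rec ⟨(1, 1), one_pos, one_pos⟩ f n
  have hs : ∀ n, s (n + 1) = f n (s n) := fun n => rfl
  refine ⟨fun n => (s (n + 1)).1.1, fun n => (s n).1.2, fun n => (s (n + 1)).2.1,
    strictAnti_nat_of_succ_lt fun n => ?_, fun n => ?_, fun n => (s n).2.2, fun n => ?_,
    fun n => ?_⟩
  · exact (hf (n + 1) (s (n + 1))).1
  · exact (hf n (s n)).2.1
  · induction n with
    | zero => exact le_rfl
    | succ n ih => exact (hf n (s n)).2.2.1.trans ih
  · exact (hf n (s n)).2.2.2

/-- Nested time windows: if within each window of length `h n` the `n`-th property holds during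
some subwindow of length `h (n + 1)`, then all properties hold simultaneously at some time. -/
lemma exists_time_of_nested {h : ℕ → ℝ} (h0 : ∀ n, 0 < h n) (h1 : ∀ n, h n ≤ 1) {N : ℕ}
    {Q : ℕ → ℝ≥0 → Prop}
    (hQ : ∀ n ≥ N, ∀ x ∈ Set.Icc (0 : ℝ) 1, ∃ y, x ≤ y ∧ y + h (n + 1) ≤ x + h n ∧
      ∀ t : ℝ≥0, y ≤ t → t ≤ y + h (n + 1) → Q n t) :
    ∃ t ∈ Set.Icc (0 : ℝ≥0) 1, ∀ n ≥ N, Q n t := by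
  -- The hypothesis on `x` moves under the existential, with default `0`, so that `choose` yields a
  -- total function to iterate.
  have hQ' : ∀ (m : ℕ) (x : ℝ), ∃ y, x ∈ Set.Icc (0 : ℝ) 1 → x ≤ y ∧
      y + h (N + m + 1) ≤ x + h (N + m) ∧
      ∀ t : ℝ≥0, y ≤ t → t ≤ y + h (N + m + 1) → Q (N + m) t := by
    intro m x
    by_cases hx : x ∈ Set.Icc (0 : ℝ) 1
    · obtain ⟨y, hy⟩ := hQ (N + m) (by omega) x hx
      exact ⟨y, fun _ => hy⟩
    · exact ⟨0, fun h => absurd h hx⟩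
  choose g hg using hQ'
  let y : ℕ → ℝ := fun m => Nat.rec 0 g m
  have hy : ∀ m, y (m + 1) = g m (y m) := fun m => rfl
  have hinv : ∀ m, 0 ≤ y m ∧ y m + h (N + m) ≤ 1 := by
    intro m
    induction m with
    | zero => exact ⟨le_rfl, by simpa [y] using h1 N⟩
    | succ m ih =>
      obtain ⟨h3, h4, _⟩ := hg m (y m) ⟨ih.1, by linarith [h0 (N + m)]⟩
      rw [← hy] at h3 h4
      exact ⟨ih.1.trans h3, h4.trans ih.2⟩
  have hstep := fun m => hg m (y m) ⟨(hinv m).1, by linarith [(hinv m).2, h0 (N + m)]⟩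
  have hmem := Monotone.ciSup_mem_iInter_Icc_of_antitone (f := y) (g := fun m => y m + h (N + m))
    (monotone_nat_of_le_succ fun m => (hstep m).1)
    (antitone_nat_of_succ_le fun m => (hstep m).2.1)
    (fun m => by simp [(h0 (N + m)).le])
  rw [Set.mem_iInter] at hmem
  set t := ⨆ n, y n
  have ht0 : 0 ≤ t := (hinv 0).1.trans (hmem 0).1
  refine ⟨⟨t, ht0⟩, ⟨zero_le, ?_⟩, fun n hn => ?_⟩
  · exact NNReal.coe_le_coe.1 ((hmem 0).2.trans (hinv 0).2)
  · obtain ⟨m, rfl⟩ := Nat.exists_eq_add_of_le hn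
    -- The subwindow on which `Q (N + m)` holds is the window with index `m + 1`.
    exact (hstep m).2.2 ⟨t, ht0⟩ (hmem (m + 1)).1 (hmem (m + 1)).2

/-- The event that the arc has a run of length `δ` at a position in `G` starting in each of the
time windows `[i * h / 2, i * h / 2 + s]` with `i ≤ 2 / h`. -/
def hasRuns {Ω : Type*} (C : ℕ → Ω → Circ) (Y : ℕ → Ω → ℝ) (G : Set Circ) (h s δ : ℝ) : Set Ω :=
  {ω | ∀ i ∈ Finset.range (⌈2 / h⌉₊ + 1), ∃ j, C j ω ∈ G ∧ i * (h / 2) ≤ waitSum Y j ω ∧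
    waitSum Y j ω ≤ i * (h / 2) + s ∧ δ < Y j ω}

/-- Rounding `x` up to the grid of mesh `h / 2` costs less than `h / 2`, and the other half of the
window has room for the search time `s` and the run. Finitely many grid windows thus serve all `x`.
-/
lemma exists_run_of_hasRuns {Ω : Type*} {C : ℕ → ℕ → Ω → Circ} {Y : ℕ → ℕ → Ω → ℝ} {ω : Ω}
    {n : ℕ} (hY : ∀ j, 0 ≤ Y n j ω) {G : Set Circ} {h s δ : ℝ} (hh : 0 < h) (hs : s + δ ≤ h / 2)
    (hω : ω ∈ hasRuns (C n) (Y n) G h s δ) {x : ℝ} (hx : x ∈ Set.Icc (0 : ℝ) 1) :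
    ∃ y, x ≤ y ∧ y + δ ≤ x + h ∧
      ∀ t : ℝ≥0, y ≤ t → t ≤ y + δ → poissonCenter C Y ω n t ∈ G := by
  have hxh : 0 ≤ x / (h / 2) := div_nonneg hx.1 (by positivity)
  have hc1 := Nat.le_ceil (x / (h / 2))
  have hc2 := Nat.ceil_lt_add_one hxh
  have hle : ⌈x / (h / 2)⌉₊ ≤ ⌈2 / h⌉₊ := by
    refine Nat.ceil_mono ?_
    rw [div_div_eq_mul_div]
    gcongr
    linarith [hx.2]
  rw [div_le_iff₀ (by positivity)] at hc1
  rw [← sub_lt_iff_lt_add, lt_div_iff₀ (by positivity), sub_mul, one_mul] at hc2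
  obtain ⟨j, hjG, hj1, hj2, hj3⟩ := hω _ (Finset.mem_range.2 (Nat.lt_succ_of_le hle))
  refine ⟨waitSum (Y n) j ω, by linarith, by linarith, fun t ht1 ht2 => ?_⟩
  rw [poissonCenter_eq (j := j) hY]
  · exact hjG
  · exact ⟨ht1, by rw [waitSum_succ]; linarith⟩

lemma IsPoissonArc.measure_compl_hasRuns_le {Ω : Type*} [MeasurableSpace Ω] {P : Measure Ω}
    {r : ℝ} {C : ℕ → Ω → Circ} {Y : ℕ → Ω → ℝ} (harc : IsPoissonArc P r C Y) (x : Circ)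
    {h η δ : ℝ} (hh : 0 < h) (hη : 0 ≤ η) (hδ : 0 ≤ δ) (k : ℕ) :
    P (hasRuns C Y (Metric.closedBall x (1 / 8)) h (k * η) δ)ᶜ ≤
      ENNReal.ofReal ((2 / h + 2) *
        ((k + 1) * Real.exp (-(r * η)) + k * (r * δ) + (3 / 4) ^ k)) := by
  have hr := harc.rate_pos
  set B := ((k : ℝ) + 1) * Real.exp (-(r * η)) + k * (r * δ) + (3 / 4) ^ k with hB
  have hB0 : 0 ≤ B := by positivity
  let S : ℕ → Set Ω := fun i => {ω | ∃ j, C j ω ∈ Metric.closedBall x (1 / 8) ∧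
    i * (h / 2) ≤ waitSum Y j ω ∧ waitSum Y j ω ≤ i * (h / 2) + k * η ∧ δ < Y j ω}ᶜ
  have hS : ∀ i, P (S i) ≤ ENNReal.ofReal B := by
    intro i
    refine (harc.measure_not_run_in_window_le (by positivity) hη hδ
      Metric.isClosed_closedBall.measurableSet k).trans (le_of_eq ?_)
    rw [volume_compl_closedBall_eighth, hB, ENNReal.ofReal_add (by positivity) (by positivity),
      ENNReal.ofReal_add (by positivity) (by positivity),
      ENNReal.ofReal_mul (p := (k : ℝ) + 1) (by positivity),
      ENNReal.ofReal_mul (p := (k : ℝ)) (by positivity), ENNReal.ofReal_pow (by positivity),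
      ENNReal.ofReal_add (by positivity) zero_le_one, ENNReal.ofReal_natCast, ENNReal.ofReal_one]
  calc _ ≤ P (⋃ i ∈ Finset.range (⌈2 / h⌉₊ + 1), S i) := by
        refine measure_mono fun ω hω => ?_
        by_contra hcon
        refine hω fun i hi => ?_
        by_contra hno
        exact hcon (Set.mem_iUnion₂.2 ⟨i, hi, hno⟩)
    _ ≤ ∑ i ∈ Finset.range (⌈2 / h⌉₊ + 1), P (S i) := measure_biUnion_finset_le _ _
    _ ≤ ∑ i ∈ Finset.range (⌈2 / h⌉₊ + 1), ENNReal.ofReal B := Finset.sum_le_sum fun i _ => hS i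
    _ = ENNReal.ofReal ((⌈2 / h⌉₊ + 1 : ℕ) * B) := by
        rw [Finset.sum_const, Finset.card_range, nsmul_eq_mul, ← ENNReal.ofReal_natCast,
          ← ENNReal.ofReal_mul (by positivity)]
    _ ≤ _ := by
        apply ENNReal.ofReal_le_ofReal
        gcongr
        have := Nat.ceil_lt_add_one (show 0 ≤ 2 / h by positivity)
        push_cast
        linarith

lemma IsPoissonModel.ae_nonDenseTimes_nonempty {Ω : Type*} [MeasurableSpace Ω] {P : Measure Ω}
    {α : ℝ} {ℓ : ℕ → ℝ} {C : ℕ → ℕ → Ω → Circ} {Y : ℕ → ℕ → Ω → ℝ}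
    (hmodel : IsPoissonModel P α ℓ C Y) (hℓ : ∀ n, 0 < ℓ n) (hℓ2 : ∀ n, ℓ n ≤ 1 / 2) {h : ℕ → ℝ}
    (h0 : ∀ n, 0 < h n) (h1 : ∀ n, h n ≤ 1)
    (hscale : ∀ n, IsRunScale α ((1 / 2) ^ n) (h n) (ℓ n) (h (n + 1))) :
    ∀ᵐ ω ∂P, (nonDenseTimes ℓ (poissonCenter C Y ω)).Nonempty := by
  choose k η hη hkη hsmall using hscale
  let G : Set Circ := Metric.closedBall ((1 / 2 : ℝ) : Circ) (1 / 8)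
  have hsum : (∑' n, P (hasRuns (C n) (Y n) G (h n) (k n * η n) (h (n + 1)))ᶜ) ≠ ∞ := by
    refine ne_top_of_le_ne_top ?_ (ENNReal.tsum_le_tsum fun n =>
      ((hmodel.arc hℓ n).measure_compl_hasRuns_le _ (h0 n) (hη n) (h0 (n + 1)).le (k n)).trans
        (ENNReal.ofReal_le_ofReal (hsmall n)))
    exact summable_geometric_two.tsum_ofReal_ne_top
  have hpos : ∀ᵐ ω ∂P, ∀ i j, 0 < Y i j ω := ae_all_iff.2 fun i =>
    (hmodel.arc hℓ i).ae_wait_pos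
  filter_upwards [ae_eventually_notMem hsum, hpos] with ω hω hYpos
  obtain ⟨N, hN⟩ := eventually_atTop.1 hω
  obtain ⟨t, ht, htG⟩ := exists_time_of_nested h0 h1 (N := N)
    (Q := fun n t => poissonCenter C Y ω n t ∈ G) fun n hn x hx =>
      exists_run_of_hasRuns (fun j => (hYpos n j).le) (h0 n) (hkη n)
        (Set.notMem_compl_iff.1 (hN n hn)) hx
  exact ⟨t, ht, not_dense_coveredIO hℓ2 htG⟩

theorem theorem1p8 :
    -- (a) the Brownian model, for every sequence of lengths
    (∀ ℓ : ℕ → ℝ, IsLengthSeq ℓ →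
      ∀ (Ω : Type*) [MeasurableSpace Ω] (P : Measure Ω) [IsProbabilityMeasure P]
        (V : ℕ → Ω → Circ) (B : ℕ → ℝ≥0 → Ω → ℝ), IsBrownianModel P V B →
        ∀ᵐ ω ∂P, nonDenseTimes ℓ (brownianCenter V B ω) = ∅) ∧
    -- (b) the Poisson model: `α > 0` and polynomially bounded lengths, or `α = 0`
    (∀ (α : ℝ) (ℓ : ℕ → ℝ), IsLengthSeq ℓ →
      ((0 < α ∧ ∃ c : ℝ, ∀ n : ℕ, ((n : ℝ) + 1) ^ (-c) ≤ ℓ n) ∨ α = 0) →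
      ∀ (Ω : Type*) [MeasurableSpace Ω] (P : Measure Ω) [IsProbabilityMeasure P]
        (C : ℕ → ℕ → Ω → Circ) (Y : ℕ → ℕ → Ω → ℝ), IsPoissonModel P α ℓ C Y →
        ∀ᵐ ω ∂P, nonDenseTimes ℓ (poissonCenter C Y ω) = ∅) ∧
    -- (c) the Poisson model with `α > 0`: some sequence has exceptional times almost surely
    (∀ α : ℝ, 0 < α →
      ∃ ℓ : ℕ → ℝ, IsLengthSeq ℓ ∧ StrictAnti ℓ ∧ ℓ 0 ≤ 1 / 2 ∧
        ∀ (Ω : Type*) [MeasurableSpace Ω] (P : Measure Ω) [IsProbabilityMeasure P]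
          (C : ℕ → ℕ → Ω → Circ) (Y : ℕ → ℕ → Ω → ℝ), IsPoissonModel P α ℓ C Y →
          ∀ᵐ ω ∂P, (nonDenseTimes ℓ (poissonCenter C Y ω)).Nonempty)
 := by
  refine ⟨fun ℓ hℓ Ω _ P _ V B h => h.ae_nonDenseTimes_eq_empty hℓ.pos,
    fun α ℓ hℓ hα Ω _ P _ C Y h => ?_, fun α hα => ?_⟩
  · obtain ⟨K, hK⟩ := exists_rate_le_pow hα
    exact h.ae_nonDenseTimes_eq_empty hℓ.pos hK
  · obtain ⟨ℓ, h, hℓ, hanti, hℓ2, h0, h1, hscale⟩ := exists_runScale_seq hα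
    have hhalf : ∀ n, ℓ n ≤ 1 / 2 := fun n =>
      (hanti.antitone (Nat.zero_le n)).trans (by simpa using hℓ2 0)
    refine ⟨ℓ, ⟨hℓ, hanti.antitone, ?_⟩, hanti, hhalf 0, fun Ω _ P _ C Y hmodel =>
      hmodel.ae_nonDenseTimes_nonempty hℓ hhalf h0 h1 hscale⟩
    refine squeeze_zero (fun n => (hℓ n).le) hℓ2 ?_
    exact (tendsto_pow_atTop_nhds_zero_of_lt_one (by norm_num) (by norm_num)).comp
      (tendsto_add_atTop_nat 1)
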